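/- Let $H$ be a complex separable Hilbert space. For a bounded operator $X$ on $H$ and $0<r<\infty$ put $|X|=(X^*X)^{1/2}$ and $\|X\|_r=(\operatorname{tr}|X|^r)^{1/r}\in[0,\infty]$, where $\operatorname{tr}$ is the usual trace of positive operators, and let $B_r(H)=\{X : \|X\|_r<\infty\}$ be the Schatten $r$-class. Let $n$ be a natural number, let $1<p\le 2$ and $\frac1p+\frac1q=1$. If $$\Big\|\sum_{i=1}^n x_i\Big\|_p^q+\sum_{1\le i<j\le n}\|x_i-x_j\|_p^q\le n\Big(\sum_{i=1}^n\|x_i\|_p^p\Big)^{q/p}\quad\text{for all } x_1,\dots,x_n\in B_p(H),$$ then $$n\Big(\sum_{i=1}^n\|\varphi_i\|_q^q\Big)^{p/q}\le\Big\|\sum_{i=1}^n\varphi_i\Big\|_q^p+\sum_{1\le i<j\le n}\|\varphi_i-\varphi_j\|_q^p\quad\text{for all }\varphi_1,\dots,\varphi_n\in B_q(H).$$ -/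

import Mathlib

open scoped ENNReal InnerProductSpace

noncomputable section

/-- The sum of the diagonal entries `⟨e i, T (e i)⟩` of a positive operator `T` in the Hilbert
basis `e`, as an element of `[0, ∞]`. -/
def diagSum {H : Type*} [NormedAddCommGroup H] [InnerProductSpace ℂ H] {ι : Type*}
    (e : HilbertBasis ι ℂ H) (T : H →L[ℂ] H) : ℝ≥0∞ :=
  ∑' i, ENNReal.ofReal (⟪e i, T (e i)⟫_ℂ).re

/-- The trace of a positive bounded operator, as an element of `[0, ∞]`. It is computed in some
Hilbert basis of `H`; by `posTrace_eq_diagSum` below every Hilbert basis gives the same value. -/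
def posTrace {H : Type*} [NormedAddCommGroup H] [InnerProductSpace ℂ H] [CompleteSpace H]
    (T : H →L[ℂ] H) : ℝ≥0∞ :=
  diagSum (exists_hilbertBasis ℂ H).choose_spec.choose T

/-- The Schatten `p`-norm `‖X‖_p = (tr |X|^p)^(1/p)` for `0 < p < ∞`, as an element of `[0, ∞]`.
Here `|X| = (X* X)^(1/2)` and its real powers are those of the continuous functional calculus. The
value is `∞` when `X` is not compact. -/
def schattenNorm {H : Type*} [NormedAddCommGroup H] [InnerProductSpace ℂ H] [CompleteSpace H]
    (p : ℝ) (X : H →L[ℂ] H) : ℝ≥0∞ :=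
  posTrace (CFC.abs X ^ p) ^ (1 / p)

/-- The Schatten class `B_p(H)`: the bounded operators of finite Schatten `p`-norm. -/
def schattenClass (H : Type*) [NormedAddCommGroup H] [InnerProductSpace ℂ H] [CompleteSpace H]
    (p : ℝ) : Set (H →L[ℂ] H) :=
  {X | schattenNorm p X < ∞}

/-- Parseval's identity in `[0, ∞]`. -/
theorem tsum_ofReal_inner_sq {H : Type*} [NormedAddCommGroup H] [InnerProductSpace ℂ H]
    {ι : Type*} (e : HilbertBasis ι ℂ H) (x : H) :
    ∑' i, ENNReal.ofReal (‖⟪e i, x⟫_ℂ‖ ^ 2) = ENNReal.ofReal (‖x‖ ^ 2) := by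
  have h := Complex.hasSum_re (e.hasSum_inner_mul_inner x x)
  have h1 : ∀ i, (⟪x, e i⟫_ℂ * ⟪e i, x⟫_ℂ).re = ‖⟪e i, x⟫_ℂ‖ ^ 2 := fun i => by
    rw [← inner_conj_symm x (e i), Complex.conj_mul']
    norm_cast
  have h2 : (⟪x, x⟫_ℂ).re = ‖x‖ ^ 2 := by
    rw [inner_self_eq_norm_sq_to_K]
    norm_cast
  simp only [h1, h2] at h
  rw [← h.tsum_eq, ENNReal.ofReal_tsum_of_nonneg (fun i => by positivity) h.summable]

theorem diagSum_star_mul_self {H : Type*} [NormedAddCommGroup H] [InnerProductSpace ℂ H]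
    [CompleteSpace H] {ι κ : Type*} (e : HilbertBasis ι ℂ H) (f : HilbertBasis κ ℂ H)
    (S : H →L[ℂ] H) :
    diagSum e (star S * S)
      = ∑' j, ENNReal.ofReal (‖ContinuousLinearMap.adjoint S (f j)‖ ^ 2) := by
  have h1 : diagSum e (star S * S) = ∑' i, ENNReal.ofReal (‖S (e i)‖ ^ 2) := by
    refine tsum_congr fun i => ?_
    have : (⟪e i, (star S * S) (e i)⟫_ℂ).re = ‖S (e i)‖ ^ 2 := by
      rw [mul_apply_eq_comp, ContinuousLinearMap.star_eq_adjoint,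
        ContinuousLinearMap.adjoint_inner_right, inner_self_eq_norm_sq_to_K]
      norm_cast
    rw [this]
  have h2 : ∀ i, ENNReal.ofReal (‖S (e i)‖ ^ 2)
      = ∑' j, ENNReal.ofReal (‖⟪f j, S (e i)⟫_ℂ‖ ^ 2) :=
    fun i => (tsum_ofReal_inner_sq f _).symm
  rw [h1, tsum_congr h2, ENNReal.tsum_comm]
  refine tsum_congr fun j => ?_
  rw [← tsum_ofReal_inner_sq e]
  refine tsum_congr fun i => ?_
  rw [ContinuousLinearMap.adjoint_inner_right, norm_inner_symm]

/-- The diagonal sum of a positive operator does not depend on the Hilbert basis. -/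
theorem diagSum_eq_diagSum {H : Type*} [NormedAddCommGroup H] [InnerProductSpace ℂ H]
    [CompleteSpace H] {ι κ : Type*} (e : HilbertBasis ι ℂ H) (f : HilbertBasis κ ℂ H)
    {T : H →L[ℂ] H} (hT : 0 ≤ T) : diagSum e T = diagSum f T := by
  obtain ⟨S, rfl⟩ := CStarAlgebra.nonneg_iff_eq_star_mul_self.mp hT
  rw [diagSum_star_mul_self e e, diagSum_star_mul_self f e]

/-- The trace of a positive operator can be computed in any Hilbert basis. -/
theorem posTrace_eq_diagSum {H : Type*} [NormedAddCommGroup H] [InnerProductSpace ℂ H]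
    [CompleteSpace H] {ι : Type*} (e : HilbertBasis ι ℂ H) {T : H →L[ℂ] H} (hT : 0 ≤ T) :
    posTrace T = diagSum e T :=
  diagSum_eq_diagSum _ e hT

end

-- Duality. With `xᵢ = φᵢ |φᵢ|^(q-2)` one has `tr (xᵢ* φᵢ) = ‖φᵢ‖_q^q = ‖xᵢ‖_p^p`. Let `S` be the
-- sum of these numbers, `L` the left side of the hypothesis for the `xᵢ`, and `R` the right side of
-- the conclusion. The polarised parallelogram identity writes `n S` as the trace pairing of the two
-- sums plus those of the differences. Hölder for the trace, then for finite sums, gives `n S ≤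
-- L^(1/q) R^(1/p)`, and the hypothesis gives `L ≤ n S^(q/p)`. Cancelling `n^(1/q) S^(1/p)` and
-- raising to the power `p` finishes. Trace Hölder (`tsum_enorm_inner_le_schattenNorm_mul`) is
-- proved for the absolute diagonal sum in one basis: a singular value decomposition of `X` reduces
-- it to `∑ aⱼ ‖Y* uⱼ‖`, and `tsum_enorm_adjoint_rpow_le` controls `∑ ‖Y* uⱼ‖^q`.

universe u

/-! ### Inequalities for series in `[0, ∞]`. -/

/-- Hölder's inequality for series in `[0, ∞]`. -/
theorem ENNReal.tsum_mul_le_Lp_mul_Lq {ι : Type*} {p q : ℝ} (hpq : p.HolderConjugate q)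
    (f g : ι → ℝ≥0∞) :
    ∑' i, f i * g i ≤ (∑' i, f i ^ p) ^ (1 / p) * (∑' i, g i ^ q) ^ (1 / q) := by
  rw [ENNReal.tsum_eq_iSup_sum]
  refine iSup_le fun s => (ENNReal.inner_le_Lp_mul_Lq s f g hpq).trans ?_
  have := hpq.pos
  have := hpq.symm.pos
  gcongr <;> exact ENNReal.sum_le_tsum s

/-- Jensen's inequality for a series in `[0, ∞]` whose weights have total mass at most `1`. -/
theorem ENNReal.tsum_mul_rpow_le {ι : Type*} {s : ℝ} (hs : 1 ≤ s) (w f : ι → ℝ≥0∞)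
    (hw : ∑' i, w i ≤ 1) : (∑' i, w i * f i) ^ s ≤ ∑' i, w i * f i ^ s := by
  have hs0 : 0 < s := by linarith
  have h : ∑' i, w i * f i ≤ (∑' i, w i * f i ^ s) ^ s⁻¹ := by
    rw [ENNReal.tsum_eq_iSup_sum]
    refine iSup_le fun t => (ENNReal.inner_le_weight_mul_Lp_of_nonneg t hs w f).trans ?_
    have h1 : (∑ i ∈ t, w i) ^ (1 - s⁻¹) ≤ 1 :=
      ENNReal.rpow_le_one ((ENNReal.sum_le_tsum t).trans hw) (by
        have := inv_le_one_of_one_le₀ hs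
        linarith)
    calc _ ≤ 1 * (∑' i, w i * f i ^ s) ^ s⁻¹ := by
          gcongr
          exact ENNReal.sum_le_tsum t
      _ = _ := one_mul _
  exact (ENNReal.le_rpow_inv_iff hs0).mp h

/-! ### Compact positive operators and singular values. -/

section Hilbert

variable {H : Type u} [NormedAddCommGroup H] [InnerProductSpace ℂ H]

/-- Parseval's identity in `[0, ∞]`, in terms of extended norms. -/
theorem HilbertBasis.tsum_enorm_inner_sq {ι : Type*} (e : HilbertBasis ι ℂ H) (x : H) :
    ∑' i, ‖⟪e i, x⟫_ℂ‖ₑ ^ 2 = ‖x‖ₑ ^ 2 := by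
  have h := tsum_ofReal_inner_sq e x
  simpa only [ENNReal.ofReal_pow (norm_nonneg _), ofReal_norm] using h

/-- Bessel's inequality in `[0, ∞]`. -/
theorem Orthonormal.tsum_enorm_inner_sq_le {ι : Type*} {v : ι → H} (hv : Orthonormal ℂ v) (x : H) :
    ∑' i, ‖⟪v i, x⟫_ℂ‖ₑ ^ 2 ≤ ‖x‖ₑ ^ 2 := by
  have h := ENNReal.ofReal_le_ofReal (hv.tsum_inner_products_le x)
  rw [ENNReal.ofReal_tsum_of_nonneg (fun i => by positivity) (hv.inner_products_summable x)] at h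
  simpa only [ENNReal.ofReal_pow (norm_nonneg _), ofReal_norm] using h

/-- The Cauchy-Schwarz inequality for the coefficients of two vectors in a Hilbert basis. -/
theorem HilbertBasis.tsum_enorm_inner_mul_le {ι : Type*} (e : HilbertBasis ι ℂ H) (x y : H) :
    ∑' i, ‖⟪x, e i⟫_ℂ‖ₑ * ‖⟪y, e i⟫_ℂ‖ₑ ≤ ‖x‖ₑ * ‖y‖ₑ := by
  refine (ENNReal.tsum_mul_le_Lp_mul_Lq Real.HolderConjugate.two_two _ _).trans_eq ?_
  have h : ∀ z : H, (∑' i, ‖⟪z, e i⟫_ℂ‖ₑ ^ (2 : ℝ)) ^ (1 / 2 : ℝ) = ‖z‖ₑ := fun z => by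
    have h1 : ∀ i, ‖⟪z, e i⟫_ℂ‖ₑ ^ (2 : ℝ) = ‖⟪e i, z⟫_ℂ‖ₑ ^ 2 := fun i => by
      rw [ENNReal.rpow_two, ← ofReal_norm, ← ofReal_norm, norm_inner_symm]
    rw [tsum_congr h1, e.tsum_enorm_inner_sq, ← ENNReal.rpow_two, one_div,
      ENNReal.rpow_rpow_inv two_ne_zero]
  rw [h, h]

variable [CompleteSpace H]

/-- The continuous functional calculus acts on an eigenvector through the eigenvalue. -/
theorem cfc_apply_of_apply_eq_smul {T : H →L[ℂ] H} (hT : IsSelfAdjoint T) {v : H} {c : ℝ}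
    (hv : T v = (c : ℂ) • v) (f : ℝ → ℝ) (hf : ContinuousOn f (spectrum ℝ T)) :
    cfc f T v = (f c : ℂ) • v := by
  rcases eq_or_ne v 0 with rfl | hv0
  · simp
  have hc : c ∈ spectrum ℝ T := by
    rw [spectrum.mem_iff]
    rintro ⟨U, hU⟩
    have h1 : (U : H →L[ℂ] H) v = 0 := by
      rw [hU, sub_apply, hv, Algebra.algebraMap_eq_smul_one]
      simp
    apply hv0
    have h2 : ((↑U⁻¹ : H →L[ℂ] H) * (U : H →L[ℂ] H)) v = v := by rw [Units.inv_mul]; rfl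
    rw [← h2, mul_apply_eq_comp, h1, map_zero]
  have key : ∀ g : C(spectrum ℝ T, ℝ), cfcHom hT g v = (g ⟨c, hc⟩ : ℂ) • v := by
    intro g
    induction g using ContinuousMap.induction_on_of_compact with
    | const r =>
      have : cfcHom hT (ContinuousMap.const (spectrum ℝ T) r) = algebraMap ℝ (H →L[ℂ] H) r :=
        AlgHomClass.commutes (cfcHom hT) r
      rw [this, Algebra.algebraMap_eq_smul_one]
      simp
    | id => rw [cfcHom_id hT]; exact hv
    | star_id => rw [map_star, cfcHom_id hT, hT.star_eq]; exact hv
    | add f g hf hg => rw [map_add, add_apply, hf, hg]; simp [add_smul]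
    | mul f g hf hg =>
      rw [map_mul, mul_apply_eq_comp, hg, map_smul, hf, smul_smul]
      simp [mul_comm]
    | frequently f hf =>
      have hcl : IsClosed {g : C(spectrum ℝ T, ℝ) | cfcHom hT g v = (g ⟨c, hc⟩ : ℂ) • v} := by
        refine isClosed_eq ?_ ?_
        · exact (ContinuousLinearMap.apply ℂ H v).continuous.comp (cfcHom_continuous hT)
        · exact (Complex.continuous_ofReal.comp (continuous_eval_const _)).smul
            continuous_const
      exact hcl.closure_subset (mem_closure_iff_frequently.mpr hf)
  rw [cfc_apply f T hT hf, key]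
  rfl

/-- Real powers of a positive operator act on an eigenvector through the eigenvalue. -/
theorem rpow_apply_of_apply_eq_smul {T : H →L[ℂ] H} (hT : 0 ≤ T) {v : H} {c : ℝ}
    (hv : T v = (c : ℂ) • v) {s : ℝ} (hs : 0 ≤ s) : (T ^ s) v = ((c ^ s : ℝ) : ℂ) • v := by
  rw [CFC.rpow_eq_cfc_real hT]
  exact cfc_apply_of_apply_eq_smul hT.isSelfAdjoint hv _
    (Real.continuous_rpow_const hs).continuousOn

/-- An operator that is square summable on a Hilbert basis is compact. -/
theorem isCompactOperator_of_tsum_enorm_sq_ne_top {ι : Type*} (e : HilbertBasis ι ℂ H)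
    (T : H →L[ℂ] H) (hT : ∑' i, ‖T (e i)‖ₑ ^ 2 ≠ ∞) : IsCompactOperator T := by
  let F : Finset ι → (H →L[ℂ] H) := fun s =>
    ∑ i ∈ s, (innerSL ℂ (e i)).smulRight (T (e i))
  have hF : ∀ s, IsCompactOperator (F s) := fun s => by
    refine (compactOperator (RingHom.id ℂ) H H).sum_mem fun i _ => ?_
    exact (isCompactOperator_id.comp_clm (innerSL ℂ (e i))).clm_comp
      ((ContinuousLinearMap.id ℂ ℂ).smulRight (T (e i)))
  -- The Hilbert-Schmidt tail `R s` bounds the operator norm of `T - F s`, so `T` is a norm limit of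
  -- finite rank operators.
  let R : Finset ι → ℝ≥0∞ := fun s => (∑' i : {i // i ∉ s}, ‖T (e i)‖ₑ ^ 2) ^ (1 / 2 : ℝ)
  have hR : Filter.Tendsto R Filter.atTop (nhds 0) := by
    have h := (ENNReal.tendsto_tsum_compl_atTop_zero hT).ennrpow_const (1 / 2 : ℝ)
    rwa [ENNReal.zero_rpow_of_pos (by norm_num)] at h
  have hbound : ∀ s x, ‖(T - F s) x‖ₑ ≤ R s * ‖x‖ₑ := fun s x => by
    have hsum : HasSum (fun i => ⟪e i, x⟫_ℂ • T (e i)) (T x) := by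
      have h := T.hasSum (e.hasSum_repr x)
      simpa only [map_smul, e.repr_apply_apply] using h
    have hsub : (T - F s) x = ∑' i : {i // i ∉ s}, ⟪e i, x⟫_ℂ • T (e i) := by
      rw [sub_apply, sub_eq_iff_eq_add', ← hsum.tsum_eq, ← hsum.summable.sum_add_tsum_subtype_compl s]
      simp [F]
    rw [hsub]
    refine enorm_tsum_le_tsum_enorm.trans ?_
    simp only [enorm_smul]
    rw [mul_comm]
    refine (ENNReal.tsum_mul_le_Lp_mul_Lq Real.HolderConjugate.two_two _ _).trans ?_
    simp only [ENNReal.rpow_two]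
    gcongr
    rw [one_div, ENNReal.rpow_inv_le_iff two_pos, ENNReal.rpow_two, ← e.tsum_enorm_inner_sq]
    exact ENNReal.tsum_comp_le_tsum_of_injective Subtype.val_injective (fun i => ‖⟪e i, x⟫_ℂ‖ₑ ^ 2)
  refine isCompactOperator_of_tendsto (l := Filter.atTop) (F := F) ?_ (.of_forall hF)
  rw [tendsto_iff_edist_tendsto_0]
  refine tendsto_of_tendsto_of_tendsto_of_le_of_le tendsto_const_nhds hR (fun _ => zero_le) fun s => ?_
  rw [edist_comm, edist_eq_enorm_sub]
  exact ContinuousLinearMap.opENorm_le_bound _ (hbound s)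

open scoped ComplexOrder in
/-- A compact positive operator has a Hilbert basis of eigenvectors. -/
theorem exists_hilbertBasis_apply_eq_smul {T : H →L[ℂ] H} (hT : 0 ≤ T) (hc : IsCompactOperator T) :
    ∃ (ι : Type u) (f : HilbertBasis ι ℂ H) (c : ι → ℝ),
      (∀ i, 0 ≤ c i) ∧ ∀ i, T (f i) = (c i : ℂ) • f i := by
  have hsa : IsSelfAdjoint T := hT.isSelfAdjoint
  have hsym : T.IsSymmetric := hsa.isSymmetric
  let E : ℂ → Submodule ℂ H := fun μ => Module.End.eigenspace (T : Module.End ℂ H) μ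
  have hcl : ∀ μ, IsClosed (E μ : Set H) := fun μ => by
    have : (E μ : Set H) = {x | T x = μ • x} := by
      ext x
      exact Module.End.mem_eigenspace_iff
    rw [this]
    exact isClosed_eq T.continuous (continuous_const_smul μ)
  have : ∀ μ, CompleteSpace (E μ) := fun μ => (hcl μ).completeSpace_coe
  -- The eigenvalue `0` is included, so the kernel contributes to the basis too.
  choose w b _ using fun μ => exists_hilbertBasis ℂ (E μ)
  let v : (Σ μ, w μ) → H := fun a => (b a.1 a.2 : E a.1)
  have hv : Orthonormal ℂ v :=
    (hsym.orthogonalFamily_eigenspaces).orthonormal_sigma_orthonormal fun μ => (b μ).orthonormal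
  have hperp : (Submodule.span ℂ (Set.range v))ᗮ = ⊥ := by
    rw [eq_bot_iff, ← ContinuousLinearMap.orthogonalComplement_iSup_eigenspaces_eq_bot hc hsym]
    intro x hx
    rw [Submodule.mem_orthogonal'] at hx
    rw [← Submodule.iInf_orthogonal, Submodule.mem_iInf]
    intro μ
    rw [Submodule.mem_orthogonal']
    intro y hy
    have h1 := (innerSL ℂ x ∘L (E μ).subtypeL).hasSum ((b μ).hasSum_repr ⟨y, hy⟩)
    have h2 : ∀ i, (innerSL ℂ x ∘L (E μ).subtypeL) ((b μ).repr ⟨y, hy⟩ i • b μ i) = 0 := fun i => by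
      have : ⟪x, ((b μ i : E μ) : H)⟫_ℂ = 0 := hx _ (Submodule.subset_span ⟨⟨μ, i⟩, rfl⟩)
      simp [this]
    simp only [h2] at h1
    exact (hasSum_zero.unique h1).symm
  refine ⟨Σ μ, w μ, HilbertBasis.mkOfOrthogonalEqBot hv hperp, fun a => a.1.re, ?_, ?_⟩
  all_goals
    intro a
    have hev : T (v a) = a.1 • v a := Module.End.mem_eigenspace_iff.mp (b a.1 a.2).2
    have hinner : ⟪v a, T (v a)⟫_ℂ = a.1 := by
      rw [hev, inner_smul_right, inner_self_eq_norm_sq_to_K, hv.1 a]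
      simp
    have hpos : (0 : ℂ) ≤ a.1 := by
      rw [← hinner]
      exact ((ContinuousLinearMap.nonneg_iff_isPositive T).mp hT).inner_nonneg_right (v a)
  · exact (Complex.le_def.mp hpos).1
  · have him : ((a.1.re : ℝ) : ℂ) = a.1 := Complex.ext rfl (Complex.le_def.mp hpos).2
    rw [HilbertBasis.coe_mkOfOrthogonalEqBot, him]
    exact hev

/-- Real powers of a positive operator with nonnegative exponents are additive in the exponent. -/
theorem rpow_add_of_nonneg (T : H →L[ℂ] H) {s t : ℝ} (hs : 0 ≤ s) (ht : 0 ≤ t) :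
    T ^ (s + t) = T ^ s * T ^ t := by
  simp only [CFC.rpow_def]
  rw [← cfc_mul (fun x : NNReal => x ^ s) (fun x : NNReal => x ^ t) T
    (NNReal.continuous_rpow_const hs).continuousOn (NNReal.continuous_rpow_const ht).continuousOn]
  exact cfc_congr fun x _ => NNReal.rpow_add_of_nonneg x hs ht

/-- A singular value decomposition of an operator `X` with `tr |X|^r < ∞`: a Hilbert basis that `X`
maps to multiples of a family that satisfies Bessel's inequality, the factors being `r`-summable
to `tr |X|^r`. -/
theorem exists_singular_value_decomposition {r : ℝ} (hr : 0 < r) (X : H →L[ℂ] H)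
    (hX : posTrace (CFC.abs X ^ r) ≠ ∞) :
    ∃ (ι : Type u) (f : HilbertBasis ι ℂ H) (a : ι → ℝ≥0∞) (u : ι → H),
      (∀ i x, ‖⟪X (f i), x⟫_ℂ‖ₑ = a i * ‖⟪u i, x⟫_ℂ‖ₑ) ∧ (∀ i, ‖u i‖ₑ ≤ 1) ∧
      (∀ x, ∑' i, ‖⟪u i, x⟫_ℂ‖ₑ ^ 2 ≤ ‖x‖ₑ ^ 2) ∧
      ∑' i, a i ^ r = posTrace (CFC.abs X ^ r) := by
  set A := CFC.abs X with hA
  have hA0 : 0 ≤ A := CFC.abs_nonneg X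
  -- `tr A^r` is the squared Hilbert-Schmidt norm of `A^(r/2)`. Hence this power is compact and can
  -- be diagonalised, and `A` is recovered as its power `2 / r`.
  set T := A ^ (r / 2) with hTdef
  have hT0 : 0 ≤ T := CFC.rpow_nonneg
  have hT2 : A ^ r = star T * T := by
    rw [hT0.isSelfAdjoint.star_eq, hTdef, ← rpow_add_of_nonneg A (by positivity) (by positivity),
      add_halves]
  have hcomp : IsCompactOperator T := by
    obtain ⟨w, e, _⟩ := exists_hilbertBasis ℂ H
    refine isCompactOperator_of_tsum_enorm_sq_ne_top e T ?_
    have h := hX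
    rw [posTrace_eq_diagSum e CFC.rpow_nonneg, hT2, diagSum_star_mul_self e e] at h
    simpa only [← ContinuousLinearMap.star_eq_adjoint, hT0.isSelfAdjoint.star_eq,
      ENNReal.ofReal_pow (norm_nonneg _), ofReal_norm] using h
  obtain ⟨ι, f, c, hc0, hc⟩ := exists_hilbertBasis_apply_eq_smul hT0 hcomp
  have hTA : T ^ (2 / r) = A := by
    rw [hTdef, CFC.rpow_rpow_of_exponent_nonneg _ _ _ (by positivity) (by positivity) hA0,
      show r / 2 * (2 / r) = 1 by field_simp, CFC.rpow_one A hA0]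
  let s : ι → ℝ := fun i => c i ^ (2 / r)
  have hs0 : ∀ i, 0 ≤ s i := fun i => Real.rpow_nonneg (hc0 i) _
  have hAf : ∀ i, A (f i) = (s i : ℂ) • f i := fun i => by
    have := rpow_apply_of_apply_eq_smul hT0 (hc i) (s := 2 / r) (by positivity)
    rwa [hTA] at this
  have hXX : ∀ i j, ⟪X (f i), X (f j)⟫_ℂ = (s i * s j : ℂ) * ⟪f i, f j⟫_ℂ := fun i j => by
    rw [← ContinuousLinearMap.adjoint_inner_right, ← ContinuousLinearMap.star_eq_adjoint,
      ← mul_apply_eq_comp, ← CFC.abs_mul_abs X, ← hA, mul_apply_eq_comp, hAf, map_smul, hAf]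
    simp only [inner_smul_right]
    by_cases hij : i = j
    · subst hij; ring
    · rw [f.orthonormal.2 hij]; simp
  -- As `0⁻¹ = 0`, `u i` vanishes where `s i = 0`; the remaining vectors are orthonormal, which is
  -- enough for Bessel.
  let u : ι → H := fun i => ((s i : ℂ)⁻¹) • X (f i)
  have huu : ∀ i j, ⟪u i, u j⟫_ℂ = ((s i : ℂ)⁻¹ * s i) * ((s j : ℂ)⁻¹ * s j) * ⟪f i, f j⟫_ℂ :=
    fun i j => by
      simp only [u, inner_smul_left, inner_smul_right, hXX, map_inv₀, Complex.conj_ofReal]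
      ring
  have hXu : ∀ i, X (f i) = (s i : ℂ) • u i := fun i => by
    by_cases h : s i = 0
    · have h0 := hXX i i
      rw [h] at h0
      simp only [Complex.ofReal_zero, zero_mul, inner_self_eq_zero] at h0
      simp [h, h0]
    · simp [u, smul_smul, h]
  have horth : Orthonormal ℂ fun i : {i // s i ≠ 0} => u i := by
    have hne : ∀ i : {i // s i ≠ 0}, (s i : ℂ) ≠ 0 := fun i => Complex.ofReal_ne_zero.mpr i.2
    classical
    rw [orthonormal_iff_ite]
    intro i j
    rw [huu, inv_mul_cancel₀ (hne i), inv_mul_cancel₀ (hne j), one_mul, one_mul,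
      orthonormal_iff_ite.mp f.orthonormal]
    simp [Subtype.ext_iff]
  have hu0 : ∀ i, s i = 0 → u i = 0 := fun i h => by simp [u, h]
  refine ⟨ι, f, fun i => ENNReal.ofReal (s i), u, ?_, ?_, ?_, ?_⟩
  · intro i x
    rw [hXu, inner_smul_left, enorm_mul, Complex.conj_ofReal, ← ofReal_norm, Complex.norm_real,
      Real.norm_of_nonneg (hs0 i)]
  · intro i
    by_cases h : s i = 0
    · simp [hu0 i h]
    · rw [← ofReal_norm, horth.1 ⟨i, h⟩, ENNReal.ofReal_one]
  · intro x
    refine le_trans (le_of_eq ?_) (horth.tsum_enorm_inner_sq_le x)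
    refine (tsum_subtype_eq_of_support_subset (s := {i | s i ≠ 0})
      (f := fun i => ‖⟪u i, x⟫_ℂ‖ₑ ^ 2) fun i hi h => hi ?_).symm
    simp [hu0 i h]
  · rw [posTrace_eq_diagSum f CFC.rpow_nonneg]
    refine tsum_congr fun i => ?_
    rw [rpow_apply_of_apply_eq_smul hA0 (hAf i) hr.le, inner_smul_right,
      inner_self_eq_norm_sq_to_K, f.orthonormal.1 i, ENNReal.ofReal_rpow_of_nonneg (hs0 i) hr.le]
    simp

end Hilbert

/-! ### Hölder's inequality for the trace pairing. -/

section Schatten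

variable {H : Type u} [NormedAddCommGroup H] [InnerProductSpace ℂ H] [CompleteSpace H]

theorem schattenNorm_rpow_self {r : ℝ} (hr : 0 < r) (X : H →L[ℂ] H) :
    schattenNorm r X ^ r = posTrace (CFC.abs X ^ r) := by
  rw [schattenNorm, one_div, ENNReal.rpow_inv_rpow hr.ne']

theorem posTrace_abs_rpow_ne_top {r : ℝ} (hr : 0 < r) {X : H →L[ℂ] H}
    (hX : schattenNorm r X ≠ ∞) : posTrace (CFC.abs X ^ r) ≠ ∞ := by
  rw [← schattenNorm_rpow_self hr]
  exact ENNReal.rpow_ne_top_of_nonneg hr.le hX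

/-- For `2 ≤ q`, the adjoint of `Y` is `q`-summable with sum at most `tr |Y|^q` on every family of
vectors of norm at most one that satisfies Bessel's inequality. -/
theorem tsum_enorm_adjoint_rpow_le {q : ℝ} (hq : 2 ≤ q) {Y : H →L[ℂ] H}
    (hY : schattenNorm q Y ≠ ∞) {κ : Type*} {u : κ → H} (hu1 : ∀ j, ‖u j‖ₑ ≤ 1)
    (hu : ∀ x, ∑' j, ‖⟪u j, x⟫_ℂ‖ₑ ^ 2 ≤ ‖x‖ₑ ^ 2) :
    ∑' j, ‖ContinuousLinearMap.adjoint Y (u j)‖ₑ ^ q ≤ schattenNorm q Y ^ q := by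
  have hq0 : 0 < q := by linarith
  obtain ⟨ι, g, b, v, hYg, hv1, hv, hb⟩ :=
    exists_singular_value_decomposition hq0 Y (posTrace_abs_rpow_ne_top hq0 hY)
  have hsq : ∀ j, ‖ContinuousLinearMap.adjoint Y (u j)‖ₑ ^ 2
      = ∑' l, ‖⟪v l, u j⟫_ℂ‖ₑ ^ 2 * b l ^ 2 := fun j => by
    rw [← g.tsum_enorm_inner_sq]
    refine tsum_congr fun l => ?_
    rw [ContinuousLinearMap.adjoint_inner_right, hYg, mul_pow, mul_comm]
  -- The matrix `|⟪v l, u j⟫|²` is doubly substochastic. Its sums over `l` permit Jensen with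
  -- exponent `q / 2 ≥ 1`; its sums over `j` are used after the interchange below.
  have hjensen : ∀ j, ‖ContinuousLinearMap.adjoint Y (u j)‖ₑ ^ q
      ≤ ∑' l, ‖⟪v l, u j⟫_ℂ‖ₑ ^ 2 * b l ^ q := fun j => by
    have h := ENNReal.tsum_mul_rpow_le (s := q / 2) (by linarith)
      (fun l => ‖⟪v l, u j⟫_ℂ‖ₑ ^ 2) (fun l => b l ^ 2)
      ((hv (u j)).trans (pow_le_one₀ zero_le (hu1 j)))
    have hpow : ∀ x : ℝ≥0∞, (x ^ 2) ^ (q / 2) = x ^ q := fun x => by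
      rw [← ENNReal.rpow_two, ← ENNReal.rpow_mul, mul_div_cancel₀ q two_ne_zero]
    rwa [← hsq, hpow, tsum_congr fun l => by rw [hpow]] at h
  calc ∑' j, ‖ContinuousLinearMap.adjoint Y (u j)‖ₑ ^ q
      ≤ ∑' j, ∑' l, ‖⟪v l, u j⟫_ℂ‖ₑ ^ 2 * b l ^ q := ENNReal.tsum_le_tsum hjensen
    _ = ∑' l, (∑' j, ‖⟪u j, v l⟫_ℂ‖ₑ ^ 2) * b l ^ q := by
      rw [ENNReal.tsum_comm]
      refine tsum_congr fun l => ?_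
      rw [← ENNReal.tsum_mul_right]
      refine tsum_congr fun j => ?_
      rw [← ofReal_norm, norm_inner_symm, ofReal_norm]
    _ ≤ ∑' l, 1 * b l ^ q := by
      gcongr with l
      exact (hu (v l)).trans (pow_le_one₀ zero_le (hv1 l))
    _ = schattenNorm q Y ^ q := by
      simp only [one_mul]
      rw [hb, schattenNorm_rpow_self hq0]

/-- Hölder's inequality for the trace pairing of two Schatten classes, computed in an arbitrary
Hilbert basis. -/
theorem tsum_enorm_inner_le_schattenNorm_mul {p q : ℝ} (hpq : p.HolderConjugate q) (hq : 2 ≤ q)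
    {X Y : H →L[ℂ] H} (hX : schattenNorm p X ≠ ∞) (hY : schattenNorm q Y ≠ ∞)
    {κ : Type*} (e : HilbertBasis κ ℂ H) :
    ∑' k, ‖⟪X (e k), Y (e k)⟫_ℂ‖ₑ ≤ schattenNorm p X * schattenNorm q Y := by
  obtain ⟨ι, f, a, u, hXf, hu1, hu, ha⟩ :=
    exists_singular_value_decomposition hpq.pos X (posTrace_abs_rpow_ne_top hpq.pos hX)
  have hexp : ∀ k, ‖⟪X (e k), Y (e k)⟫_ℂ‖ₑ
      ≤ ∑' j, a j * (‖⟪f j, e k⟫_ℂ‖ₑ * ‖⟪ContinuousLinearMap.adjoint Y (u j), e k⟫_ℂ‖ₑ) := by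
    intro k
    rw [← ContinuousLinearMap.adjoint_inner_right, ← f.tsum_inner_mul_inner]
    refine enorm_tsum_le_tsum_enorm.trans (ENNReal.tsum_le_tsum fun j => le_of_eq ?_)
    rw [enorm_mul, ContinuousLinearMap.adjoint_inner_right, hXf,
      ContinuousLinearMap.adjoint_inner_left, ← ofReal_norm, norm_inner_symm, ofReal_norm]
    ring
  calc ∑' k, ‖⟪X (e k), Y (e k)⟫_ℂ‖ₑ
      ≤ ∑' k, ∑' j, a j *
          (‖⟪f j, e k⟫_ℂ‖ₑ * ‖⟪ContinuousLinearMap.adjoint Y (u j), e k⟫_ℂ‖ₑ) :=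
        ENNReal.tsum_le_tsum hexp
    _ = ∑' j, a j * ∑' k,
          (‖⟪f j, e k⟫_ℂ‖ₑ * ‖⟪ContinuousLinearMap.adjoint Y (u j), e k⟫_ℂ‖ₑ) := by
        rw [ENNReal.tsum_comm]
        exact tsum_congr fun j => ENNReal.tsum_mul_left
    _ ≤ ∑' j, a j * ‖ContinuousLinearMap.adjoint Y (u j)‖ₑ := by
        gcongr with j
        refine (e.tsum_enorm_inner_mul_le _ _).trans_eq ?_
        rw [← ofReal_norm (f j), f.orthonormal.1 j, ENNReal.ofReal_one, one_mul]
    _ ≤ (∑' j, a j ^ p) ^ (1 / p)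
          * (∑' j, ‖ContinuousLinearMap.adjoint Y (u j)‖ₑ ^ q) ^ (1 / q) :=
        ENNReal.tsum_mul_le_Lp_mul_Lq hpq _ _
    _ ≤ schattenNorm p X * schattenNorm q Y := by
        rw [ha, ← schattenNorm]
        gcongr
        rw [one_div, ENNReal.rpow_inv_le_iff hpq.symm.pos]
        exact tsum_enorm_adjoint_rpow_le hq hY hu1 hu

/-! ### The dual element. -/

/-- The operator `φ |φ|^(q - 2)`, which is dual to `φ` for the trace pairing. -/
noncomputable def schattenDual (q : ℝ) (φ : H →L[ℂ] H) : H →L[ℂ] H :=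
  φ * CFC.abs φ ^ (q - 2)

theorem star_schattenDual_mul {q : ℝ} (hq : 2 ≤ q) (φ : H →L[ℂ] H) :
    star (schattenDual q φ) * φ = CFC.abs φ ^ q := by
  have hA : 0 ≤ CFC.abs φ := CFC.abs_nonneg φ
  have h2 : star φ * φ = CFC.abs φ ^ (2 : ℝ) := by
    rw [← CFC.abs_sq φ, ← CFC.rpow_natCast _ 2 hA]
    norm_num
  have hs : star (CFC.abs φ ^ (q - 2)) = CFC.abs φ ^ (q - 2) :=
    (CFC.rpow_nonneg (a := CFC.abs φ)).isSelfAdjoint.star_eq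
  rw [schattenDual, star_mul, hs, mul_assoc, h2,
    ← rpow_add_of_nonneg _ (by linarith) (by norm_num), sub_add_cancel]

/-- `|φ|^q |φ|^(q-2)` is the square of the positive operator `|φ|^(q-1)`, and positive square roots
are unique. -/
theorem abs_schattenDual {q : ℝ} (hq : 2 ≤ q) (φ : H →L[ℂ] H) :
    CFC.abs (schattenDual q φ) = CFC.abs φ ^ (q - 1) := by
  have hA : 0 ≤ CFC.abs φ := CFC.abs_nonneg φ
  have h : star (schattenDual q φ) * schattenDual q φ
      = CFC.abs φ ^ (q - 1) * CFC.abs φ ^ (q - 1) := by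
    nth_rewrite 2 [schattenDual]
    rw [← mul_assoc, star_schattenDual_mul hq, ← rpow_add_of_nonneg _ (by linarith) (by linarith),
      ← rpow_add_of_nonneg _ (by linarith) (by linarith)]
    congr 1
    ring
  rw [CFC.abs, h, CFC.sqrt_mul_self _ CFC.rpow_nonneg]

theorem schattenNorm_schattenDual_rpow {p q : ℝ} (hpq : p.HolderConjugate q) (hq : 2 ≤ q)
    (φ : H →L[ℂ] H) : schattenNorm p (schattenDual q φ) ^ p = schattenNorm q φ ^ q := by
  rw [schattenNorm_rpow_self hpq.pos, schattenNorm_rpow_self hpq.symm.pos, abs_schattenDual hq,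
    CFC.rpow_rpow_of_exponent_nonneg _ _ _ (by linarith) hpq.nonneg (CFC.abs_nonneg φ),
    hpq.symm.sub_one_mul_conj]

theorem tsum_re_inner_schattenDual {q : ℝ} (hq : 2 ≤ q) (φ : H →L[ℂ] H)
    {κ : Type*} (e : HilbertBasis κ ℂ H) :
    ∑' k, ENNReal.ofReal (⟪schattenDual q φ (e k), φ (e k)⟫_ℂ).re = schattenNorm q φ ^ q := by
  rw [schattenNorm_rpow_self (by linarith), posTrace_eq_diagSum e CFC.rpow_nonneg,
    ← star_schattenDual_mul hq]
  refine tsum_congr fun k => ?_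
  rw [mul_apply_eq_comp, ContinuousLinearMap.star_eq_adjoint,
    ContinuousLinearMap.adjoint_inner_right]

-- Positivity of each diagonal entry ensures that `ENNReal.ofReal` truncates nothing and commutes
-- with finite sums.
open scoped ComplexOrder in
theorem re_inner_schattenDual_nonneg {q : ℝ} (hq : 2 ≤ q) (φ : H →L[ℂ] H) (x : H) :
    0 ≤ (⟪schattenDual q φ x, φ x⟫_ℂ).re := by
  rw [← ContinuousLinearMap.adjoint_inner_right, ← ContinuousLinearMap.star_eq_adjoint,
    ← mul_apply_eq_comp, star_schattenDual_mul hq]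
  exact (Complex.le_def.mp (((ContinuousLinearMap.nonneg_iff_isPositive _).mp
    CFC.rpow_nonneg).inner_nonneg_right x)).1

end Schatten

/-! ### The parallelogram identity and the duality estimate. -/

/-- The polarised form of `‖∑ xᵢ‖² + ∑_{i<j} ‖xᵢ - xⱼ‖² = n ∑ ‖xᵢ‖²`. -/
theorem inner_sum_sum_add_sum_inner_sub_sub {H : Type*} [NormedAddCommGroup H]
    [InnerProductSpace ℂ H] {n : ℕ} (x y : Fin n → H) :
    ⟪∑ i, x i, ∑ i, y i⟫_ℂ + ∑ i, ∑ j ∈ Finset.Ioi i, ⟪x i - x j, y i - y j⟫_ℂ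
      = n * ∑ i, ⟪x i, y i⟫_ℂ := by
  have hsplit : ∀ g : Fin n → Fin n → ℂ, ∑ i, ∑ j, g i j
      = ∑ i, g i i + ∑ i, ∑ j ∈ Finset.Ioi i, (g i j + g j i) := fun g => by
    have h := Finset.sum_sum_Ioi_add_eq_sum_sum_off_diag fun i j => g j i
    rw [h, ← Finset.sum_add_distrib]
    exact Finset.sum_congr rfl fun i _ => Fintype.sum_eq_add_sum_compl i _
  rw [sum_inner]
  simp only [inner_sum]
  rw [hsplit, add_assoc, ← Finset.sum_add_distrib]
  simp only [← Finset.sum_add_distrib]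
  -- Writing the factor `n` as a sum over a dummy `j` lets `hsplit` apply to both sides, which then
  -- agree pair by pair.
  have h' : ∑ i : Fin n, ∑ _j : Fin n, ⟪x i, y i⟫_ℂ = n * ∑ i, ⟪x i, y i⟫_ℂ := by
    simp [Finset.mul_sum]
  rw [← h', hsplit fun i _ => ⟪x i, y i⟫_ℂ, ← Finset.sum_add_distrib]
  refine Finset.sum_congr rfl fun i _ => congrArg _ (Finset.sum_congr rfl fun j _ => ?_)
  simp only [inner_sub_left, inner_sub_right]
  ring

/-- Hölder's inequality for a term and a double sum over pairs `i < j`. -/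
theorem ENNReal.mul_add_sum_sum_Ioi_mul_le {n : ℕ} {p q : ℝ} (hpq : p.HolderConjugate q)
    (a b : ℝ≥0∞) (f g : Fin n → Fin n → ℝ≥0∞) :
    a * b + ∑ i, ∑ j ∈ Finset.Ioi i, f i j * g i j
      ≤ (a ^ p + ∑ i, ∑ j ∈ Finset.Ioi i, f i j ^ p) ^ (1 / p)
        * (b ^ q + ∑ i, ∑ j ∈ Finset.Ioi i, g i j ^ q) ^ (1 / q) := by
  have h := ENNReal.inner_le_Lp_mul_Lq
    -- The index `none` carries the single term `a * b`.
    (Finset.insertNone (Finset.univ.sigma fun i : Fin n => Finset.Ioi i))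
    (fun o => o.elim a fun m => f m.1 m.2) (fun o => o.elim b fun m => g m.1 m.2) hpq
  simpa only [Finset.sum_insertNone, Finset.sum_sigma, Option.elim] using h

/-- The trace pairing of the families `xᵢ = φᵢ |φᵢ|^(q - 2)` and `φᵢ`, rewritten and estimated
through sums and differences. -/
theorem card_mul_sum_schattenNorm_rpow_le {H : Type*} [NormedAddCommGroup H]
    [InnerProductSpace ℂ H] [CompleteSpace H] {n : ℕ} {p q : ℝ} (hpq : p.HolderConjugate q)
    (hq : 2 ≤ q) (x φ : Fin n → (H →L[ℂ] H)) (hx : ∀ i, x i = schattenDual q (φ i))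
    (hxs : schattenNorm p (∑ i, x i) ≠ ∞)
    (hxd : ∀ i, ∀ j ∈ Finset.Ioi i, schattenNorm p (x i - x j) ≠ ∞)
    (hφs : schattenNorm q (∑ i, φ i) ≠ ∞)
    (hφd : ∀ i, ∀ j ∈ Finset.Ioi i, schattenNorm q (φ i - φ j) ≠ ∞) :
    (n : ℝ≥0∞) * ∑ i, schattenNorm q (φ i) ^ q
      ≤ schattenNorm p (∑ i, x i) * schattenNorm q (∑ i, φ i)
        + ∑ i, ∑ j ∈ Finset.Ioi i, schattenNorm p (x i - x j) * schattenNorm q (φ i - φ j) := by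
  obtain ⟨w, e, _⟩ := exists_hilbertBasis ℂ H
  -- The identity is applied to the vectors `x i (e k)` and `φ i (e k)` for each `k`, so linearity
  -- of the trace is never needed.
  have hpt : ∀ k, (n : ℝ≥0∞) * ∑ i, ENNReal.ofReal (⟪x i (e k), φ i (e k)⟫_ℂ).re
      ≤ ‖⟪(∑ i, x i) (e k), (∑ i, φ i) (e k)⟫_ℂ‖ₑ
        + ∑ i, ∑ j ∈ Finset.Ioi i, ‖⟪(x i - x j) (e k), (φ i - φ j) (e k)⟫_ℂ‖ₑ := fun k => by
    have hnn : ∀ i ∈ Finset.univ, 0 ≤ (⟪x i (e k), φ i (e k)⟫_ℂ).re := fun i _ => by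
      rw [hx]
      exact re_inner_schattenDual_nonneg hq _ _
    have hid := inner_sum_sum_add_sum_inner_sub_sub (fun i => x i (e k)) fun i => φ i (e k)
    calc (n : ℝ≥0∞) * ∑ i, ENNReal.ofReal (⟪x i (e k), φ i (e k)⟫_ℂ).re
        = ENNReal.ofReal ((n : ℂ) * ∑ i, ⟪x i (e k), φ i (e k)⟫_ℂ).re := by
          rw [← ENNReal.ofReal_sum_of_nonneg hnn, ← ENNReal.ofReal_natCast,
            ← ENNReal.ofReal_mul (Nat.cast_nonneg n), ← Complex.re_sum, ← Complex.ofReal_natCast,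
            Complex.re_ofReal_mul]
      _ ≤ ‖(n : ℂ) * ∑ i, ⟪x i (e k), φ i (e k)⟫_ℂ‖ₑ := by
          rw [← ofReal_norm]
          exact ENNReal.ofReal_le_ofReal (Complex.re_le_norm _)
      _ ≤ _ := by
          rw [← hid]
          simp only [sum_apply, sub_apply]
          refine (enorm_add_le _ _).trans (add_le_add_right ?_ _)
          refine (enorm_sum_le _ _).trans (Finset.sum_le_sum fun i _ => ?_)
          exact enorm_sum_le _ _
  calc (n : ℝ≥0∞) * ∑ i, schattenNorm q (φ i) ^ q
      = ∑' k, (n : ℝ≥0∞) * ∑ i, ENNReal.ofReal (⟪x i (e k), φ i (e k)⟫_ℂ).re := by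
        rw [ENNReal.tsum_mul_left, Summable.tsum_finsetSum fun _ _ => ENNReal.summable]
        congr 1
        refine Finset.sum_congr rfl fun i _ => ?_
        rw [hx, tsum_re_inner_schattenDual hq]
    _ ≤ _ := ENNReal.tsum_le_tsum hpt
    _ = ∑' k, ‖⟪(∑ i, x i) (e k), (∑ i, φ i) (e k)⟫_ℂ‖ₑ
        + ∑ i, ∑ j ∈ Finset.Ioi i, ∑' k, ‖⟪(x i - x j) (e k), (φ i - φ j) (e k)⟫_ℂ‖ₑ := by
        rw [ENNReal.tsum_add, Summable.tsum_finsetSum fun _ _ => ENNReal.summable]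
        congr 1
        exact Finset.sum_congr rfl fun i _ =>
          Summable.tsum_finsetSum fun _ _ => ENNReal.summable
    _ ≤ _ := by
        refine add_le_add (tsum_enorm_inner_le_schattenNorm_mul hpq hq hxs hφs e)
          (Finset.sum_le_sum fun i _ => Finset.sum_le_sum fun j hj => ?_)
        exact tsum_enorm_inner_le_schattenNorm_mul hpq hq (hxd i j hj) (hφd i j hj) e

theorem theorem2p3 {H : Type*} [NormedAddCommGroup H] [InnerProductSpace ℂ H] [CompleteSpace H]
    [TopologicalSpace.SeparableSpace H] (n : ℕ) (p q : ℝ) (hp1 : 1 < p) (hp2 : p ≤ 2)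
    (hpq : 1 / p + 1 / q = 1)
    (h : ∀ x : Fin n → (H →L[ℂ] H), (∀ i, x i ∈ schattenClass H p) →
      schattenNorm p (∑ i, x i) ^ q
          + ∑ i, ∑ j ∈ Finset.Ioi i, schattenNorm p (x i - x j) ^ q
        ≤ (n : ℝ≥0∞) * (∑ i, schattenNorm p (x i) ^ p) ^ (q / p)) :
    ∀ φ : Fin n → (H →L[ℂ] H), (∀ i, φ i ∈ schattenClass H q) →
      (n : ℝ≥0∞) * (∑ i, schattenNorm q (φ i) ^ q) ^ (p / q)
        ≤ schattenNorm q (∑ i, φ i) ^ p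
          + ∑ i, ∑ j ∈ Finset.Ioi i, schattenNorm q (φ i - φ j) ^ p := by
  intro φ hφ
  have hc : p.HolderConjugate q := by
    rw [Real.holderConjugate_iff, ← one_div, ← one_div]
    exact ⟨hp1, hpq⟩
  have hp0 : 0 < p := hc.pos
  have hq0 : 0 < q := hc.symm.pos
  have hq2 : 2 ≤ q := by
    have h1 : 1 / 2 ≤ 1 / p := one_div_le_one_div_of_le hp0 hp2
    have h2 : 1 / q ≤ 1 / 2 := by linarith
    exact (one_div_le_one_div hq0 two_pos).mp h2
  set x : Fin n → (H →L[ℂ] H) := fun i => schattenDual q (φ i) with hxdef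
  have hxnorm : ∀ i, schattenNorm p (x i) ^ p = schattenNorm q (φ i) ^ q := fun i =>
    schattenNorm_schattenDual_rpow hc hq2 (φ i)
  have hφfin : ∀ i, schattenNorm q (φ i) ^ q ≠ ∞ := fun i =>
    ENNReal.rpow_ne_top_of_nonneg hq0.le (hφ i).ne
  have hxfin : ∀ i, x i ∈ schattenClass H p := fun i => by
    refine Ne.lt_top (a := schattenNorm p (x i)) fun htop => hφfin i ?_
    rw [← hxnorm, htop, ENNReal.top_rpow_of_pos hp0]
  have hx := h x hxfin
  simp only [hxnorm] at hx
  set S := ∑ i, schattenNorm q (φ i) ^ q with hS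
  set L := schattenNorm p (∑ i, x i) ^ q
    + ∑ i, ∑ j ∈ Finset.Ioi i, schattenNorm p (x i - x j) ^ q with hL
  set R := schattenNorm q (∑ i, φ i) ^ p
    + ∑ i, ∑ j ∈ Finset.Ioi i, schattenNorm q (φ i - φ j) ^ p with hR
  have hStop : S ≠ ∞ := ENNReal.sum_ne_top.mpr fun i _ => hφfin i
  -- The hypothesis itself makes the norms of the sum and differences of the `x i` finite;
  -- Minkowski's inequality is not needed. For the `φ i`, the case `R = ∞` is trivial.
  have hLtop : L ≠ ∞ := ne_top_of_le_ne_top (ENNReal.mul_ne_top (ENNReal.natCast_ne_top n)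
    (ENNReal.rpow_ne_top_of_nonneg (by positivity) hStop)) hx
  by_cases hRtop : R = ∞
  · rw [hRtop]
    exact le_top
  by_cases hS0 : S = 0
  · rw [hS0, ENNReal.zero_rpow_of_pos (by positivity), mul_zero]
    exact zero_le
  have hfin : ∀ {r : ℝ} {a : ℝ≥0∞}, 0 < r → a ^ r ≠ ∞ → a ≠ ∞ := fun hr h htop =>
    h (by rw [htop, ENNReal.top_rpow_of_pos hr])
  have hpair : (n : ℝ≥0∞) * S ≤ L ^ (1 / q) * R ^ (1 / p) := by
    rw [hL, ENNReal.add_ne_top, ENNReal.sum_ne_top] at hLtop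
    rw [hR, ← Ne, ENNReal.add_ne_top, ENNReal.sum_ne_top] at hRtop
    refine (card_mul_sum_schattenNorm_rpow_le hc hq2 x φ (fun _ => rfl) (hfin hq0 hLtop.1)
      (fun i j hj => hfin hq0 (ENNReal.sum_ne_top.mp (hLtop.2 i (Finset.mem_univ i)) j hj))
      (hfin hp0 hRtop.1)
      (fun i j hj => hfin hp0 (ENNReal.sum_ne_top.mp (hRtop.2 i (Finset.mem_univ i)) j hj))).trans ?_
    exact ENNReal.mul_add_sum_sum_Ioi_mul_le hc.symm _ _ _ _
  have hpair' : (n : ℝ≥0∞) * S ≤ (n : ℝ≥0∞) ^ (1 / q) * S ^ (1 / p) * R ^ (1 / p) := by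
    refine hpair.trans ?_
    gcongr
    calc L ^ (1 / q) ≤ (n * S ^ (q / p)) ^ (1 / q) := by gcongr
      _ = (n : ℝ≥0∞) ^ (1 / q) * S ^ (1 / p) := by
        rw [ENNReal.mul_rpow_of_nonneg _ _ (by positivity), ← ENNReal.rpow_mul]
        congr 2
        field_simp
  rcases Nat.eq_zero_or_pos n with hn | hn
  · simp [hn]
  have hn0 : (n : ℝ≥0∞) ≠ 0 := by exact_mod_cast hn.ne'
  have hntop : (n : ℝ≥0∞) ≠ ∞ := ENNReal.natCast_ne_top n
  have hsplit : ∀ a : ℝ≥0∞, a ≠ 0 → a ≠ ∞ → a = a ^ (1 / q) * a ^ (1 / p) := fun a h0 ht => by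
    rw [← ENNReal.rpow_add _ _ h0 ht, add_comm, hpq, ENNReal.rpow_one]
  -- Cancel `n^(1/q) S^(1/p)`, which is neither `0` nor `∞`, using `1/p + 1/q = 1`.
  have hroot : (n : ℝ≥0∞) ^ (1 / p) * S ^ (1 / q) ≤ R ^ (1 / p) := by
    have hc0 : (n : ℝ≥0∞) ^ (1 / q) * S ^ (1 / p) ≠ 0 := by
      refine mul_ne_zero ?_ ?_ <;> rw [Ne, ENNReal.rpow_eq_zero_iff_of_pos (by positivity)] <;>
        assumption
    have hctop : (n : ℝ≥0∞) ^ (1 / q) * S ^ (1 / p) ≠ ∞ := ENNReal.mul_ne_top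
      (ENNReal.rpow_ne_top_of_nonneg (by positivity) hntop)
      (ENNReal.rpow_ne_top_of_nonneg (by positivity) hStop)
    rw [← ENNReal.mul_le_mul_iff_right hc0 hctop]
    refine le_trans (le_of_eq ?_) hpair'
    conv_rhs => rw [hsplit n hn0 hntop, hsplit S hS0 hStop]
    ring
  have hfinal := ENNReal.rpow_le_rpow hroot hp0.le
  rw [ENNReal.mul_rpow_of_nonneg _ _ hp0.le, ← ENNReal.rpow_mul, ← ENNReal.rpow_mul,
    ← ENNReal.rpow_mul, one_div_mul_cancel hp0.ne', ENNReal.rpow_one, ENNReal.rpow_one,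
    one_div_mul_eq_div] at hfinal
  exact hfinal
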